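/- For every integer $k\ge 2$, the problems $\widehat{\mathsf{WF}}$ and $\widehat{\mathsf{HPC}(k)}$ are strongly Weihrauch equivalent: $\widehat{\mathsf{WF}}\equiv_{\mathrm{sW}}\widehat{\mathsf{HPC}(k)}$. Here: (i) $\mathsf{WF}$ takes as input a tree $T\subseteq\mathbb N^{<\mathbb N}$ (a set of finite sequences closed under initial segments, given by its characteristic function) and outputs $1$ if $T$ has no infinite path and $0$ otherwise. (ii) $\mathsf{HPC}(k)$ takes as input a hypergraph $H=(V,E)$ with vertex set $V\subseteq\mathbb N$ and a countable set $E$ of edges, each an arbitrary (possibly infinite) subset of $V$, given by the characteristic function of $V$ and an enumeration of $E$ by characteristic functions. It outputs $1$ if there is a coloring $f:V\to\{0,\dots,k-1\}$ such that every edge with at least two vertices contains two vertices of different colors, and $0$ otherwise. (iii) For a problem (partial multi-valued function) $f:\subseteq X\rightrightarrows Y$ between represented spaces, the parallelization $\widehat f:\subseteq X^{\mathbb N}\rightrightarrows Y^{\mathbb N}$ maps $(x_i)_{i\in\mathbb N}$ to the set of all $(y_i)_{i\in\mathbb N}$ with $y_i\in f(x_i)$ for every $i$. (iv) A realizer of $f$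 is a partial function on $\mathbb N^{\mathbb N}$ that maps every name of every $x\in\operatorname{dom} f$ to a name of some $y\in f(x)$. One writes $f\le_{\mathrm{sW}}g$ if there are computable partial functions $K,H$ on $\mathbb N^{\mathbb N}$ such that $K\circ G\circ H$ is a realizer of $f$ for every realizer $G$ of $g$, and $f\equiv_{\mathrm{sW}}g$ if $f\le_{\mathrm{sW}}g$ and $g\le_{\mathrm{sW}}f$. -/

import Mathlib

namespace Weihrauch

/-! ### Computable functionals on Baire space -/

/-- Baire space, whose points serve as names of mathematical objects. -/
abbrev Baire : Type := ℕ → ℕ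

/-- The finite initial segment `⟨p 0, …, p (m - 1)⟩` of `p`. -/
def initSeg (p : Baire) (m : ℕ) : List ℕ := (List.range m).map p

/-- A partial function on Baire space is computable if one algorithm, run on finite initial segments
of the input `p`, produces the output sequence digit by digit: on an initial segment of `p` and a
position `n` the algorithm `g` either has no answer yet (`none`) or gives the correct digit, and for
each `n` some initial segment of `p` is long enough to get the answer. As usual, nothing is required
of the algorithm on inputs outside the domain of `F`. -/
def IsComputable (F : Baire →. Baire) : Prop :=
  ∃ g : List ℕ → ℕ → Option ℕ, Computable₂ g ∧
    ∀ p q : Baire, q ∈ F p → ∀ n : ℕ,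
      (∃ m : ℕ, g (initSeg p m) n = some (q n)) ∧
      ∀ m y : ℕ, g (initSeg p m) n = some y → y = q n

/-! ### Represented spaces -/

/-- A representation of `X`: a partial surjection from Baire space onto `X`, given by its graph
(`IsName p x` means that `p` is a name of `x`). -/
class Represented (X : Type*) where
  /-- `IsName p x`: the sequence `p` is a name of `x`. -/
  IsName : Baire → X → Prop
  unique : ∀ p x y, IsName p x → IsName p y → x = y
  exists_name : ∀ x, ∃ p, IsName p x

/-- A natural number is named by the sequences whose first entry is that number. -/
instance : Represented ℕ where
  IsName p n := p 0 = n
  unique := by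
    intro p x y hx hy
    exact hx.symm.trans hy
  exists_name n := ⟨fun _ => n, rfl⟩

/-- A name of a sequence of points is a sequence of names `⟨p₀, p₁, …⟩`, coded as one element of
Baire space through the pairing function. -/
instance {X : Type*} [Represented X] : Represented (ℕ → X) where
  IsName p x := ∀ i, Represented.IsName (fun n => p (Nat.pair i n)) (x i)
  unique := by
    intro p x y hx hy
    funext i
    exact Represented.unique _ _ _ (hx i) (hy i)
  exists_name x := by
    choose q hq using fun i => Represented.exists_name (x i)
    refine ⟨fun c => q c.unpair.1 c.unpair.2, fun i => ?_⟩
    simpa using hq i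

/-! ### Problems and strong Weihrauch reducibility -/

/-- A partial function `F` on Baire space realizes the problem (partial multi-valued function)
`f : X ⇉ Y` with domain `{x | (f x).Nonempty}` if it maps every name of an `x` in the domain to a
name of some `y ∈ f x`. -/
def Realizes {X Y : Type*} [Represented X] [Represented Y]
    (F : Baire →. Baire) (f : X → Set Y) : Prop :=
  ∀ (p : Baire) (x : X), Represented.IsName p x → (f x).Nonempty →
    ∃ q ∈ F p, ∃ y ∈ f x, Represented.IsName q y

/-- Strong Weihrauch reducibility: there are computable partial functions `K` and `H` on Baire space
such that `K ∘ G ∘ H` realizes `f` whenever `G` realizes `g`. -/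
def StrongReducible {X Y Z W : Type*} [Represented X] [Represented Y] [Represented Z]
    [Represented W] (f : X → Set Y) (g : Z → Set W) : Prop :=
  ∃ K H : Baire →. Baire, IsComputable K ∧ IsComputable H ∧
    ∀ G : Baire →. Baire, Realizes G g → Realizes (K.comp (G.comp H)) f

/-- Strong Weihrauch equivalence. -/
def StrongEquiv {X Y Z W : Type*} [Represented X] [Represented Y] [Represented Z]
    [Represented W] (f : X → Set Y) (g : Z → Set W) : Prop :=
  StrongReducible f g ∧ StrongReducible g f

/-- The (infinite) parallelization of a problem: it solves countably many instances at once. -/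
def parallelization {X Y : Type*} (f : X → Set Y) : (ℕ → X) → Set (ℕ → Y) :=
  fun x => {y | ∀ i, y i ∈ f (x i)}

/-! ### Trees and the problem `WF` -/

open Classical in
/-- The sequence `p`, read off at the indices `c a`, is the characteristic function of `A`. -/
def IsCharFun {α : Type*} (p : Baire) (c : α → ℕ) (A : Set α) : Prop :=
  ∀ a, p (c a) = if a ∈ A then 1 else 0

theorem IsCharFun.unique {α : Type*} {p : Baire} {c : α → ℕ} {A B : Set α}
    (hA : IsCharFun p c A) (hB : IsCharFun p c B) : A = B := by
  classical
  ext a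
  have h := (hA a).symm.trans (hB a)
  by_cases h1 : a ∈ A <;> by_cases h2 : a ∈ B <;> simp_all

/-- Trees of finite sequences of natural numbers. -/
abbrev Tree : Type := Descriptive.tree ℕ

/-- `f` is an infinite path through `T`: all its finite initial segments lie in `T`. -/
def IsPath (T : Tree) (f : ℕ → ℕ) : Prop := ∀ n, initSeg f n ∈ T

/-- A tree is well-founded if it has no infinite path. -/
def NoInfinitePath (T : Tree) : Prop := ¬ ∃ f : ℕ → ℕ, IsPath T f

/-- A tree is named by its characteristic function, via the coding of finite sequences by natural
numbers. -/
instance : Represented Tree where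
  IsName p T := IsCharFun p (Encodable.encode : List ℕ → ℕ) (T : Set (List ℕ))
  unique := by
    intro p S T hS hT
    exact SetLike.coe_injective (IsCharFun.unique hS hT)
  exists_name T := by
    classical
    refine ⟨fun c => if ∃ σ ∈ T, Encodable.encode σ = c then 1 else 0, fun σ => ?_⟩
    simp

open Classical in
/-- The problem `WF`: given a tree, output `1` if it is well-founded and `0` otherwise. -/
noncomputable def WF : Tree → Set ℕ :=
  fun T => {if NoInfinitePath T then 1 else 0}

/-! ### Hypergraphs and the problem `HPC k` -/

/-- Hypergraphs whose vertices are (coded by) natural numbers, with countably many edges; edges are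
arbitrary, possibly infinite, sets of vertices. -/
abbrev CountableHypergraph : Type := {H : Hypergraph ℕ // H.edgeSet.Countable}

/-- `f` is a proper coloring of `H`: each edge with at least two vertices contains vertices of
different colors. -/
def IsProperColoring (H : Hypergraph ℕ) {k : ℕ} (f : H.vertexSet → Fin k) : Prop :=
  ∀ e ∈ H.edgeSet, e.Nontrivial → ∃ u v : H.vertexSet, (u : ℕ) ∈ e ∧ (v : ℕ) ∈ e ∧ f u ≠ f v

/-- A name of a hypergraph codes (the characteristic functions of) its vertex set, a set `J` of edge
indices, and a sequence `e 0, e 1, …` of sets such that the `e j` with `j ∈ J` are the edges. The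
index set makes room for hypergraphs with finitely many, or no, edges. -/
instance : Represented CountableHypergraph where
  IsName p H := ∃ (J : Set ℕ) (e : ℕ → Set ℕ),
    IsCharFun p (fun v => Nat.pair 0 v) H.1.vertexSet ∧
    IsCharFun p (fun j => Nat.pair 1 j) J ∧
    (∀ j, IsCharFun p (fun v => Nat.pair (j + 2) v) (e j)) ∧
    H.1.edgeSet = e '' J
  unique := by
    rintro p H H' ⟨J, e, hV, hJ, he, hE⟩ ⟨J', e', hV', hJ', he', hE'⟩
    have h1 : J = J' := hJ.unique hJ'
    have h2 : e = e' := funext fun j => (he j).unique (he' j)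
    subst h1 h2
    exact Subtype.ext (Hypergraph.ext (hV.unique hV') (hE.trans hE'.symm))
  exists_name H := by
    classical
    obtain ⟨J, e, hE⟩ : ∃ (J : Set ℕ) (e : ℕ → Set ℕ), H.1.edgeSet = e '' J := by
      rcases H.1.edgeSet.eq_empty_or_nonempty with h | h
      · exact ⟨∅, fun _ => ∅, by simp [h]⟩
      · obtain ⟨e, he⟩ := H.2.exists_eq_range h
        exact ⟨Set.univ, e, by simp [he]⟩
    refine ⟨fun c =>
      if c.unpair.1 = 0 then (if c.unpair.2 ∈ H.1.vertexSet then 1 else 0)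
      else if c.unpair.1 = 1 then (if c.unpair.2 ∈ J then 1 else 0)
      else (if c.unpair.2 ∈ e (c.unpair.1 - 2) then 1 else 0), J, e, ?_, ?_, ?_, hE⟩
    · intro v; simp
    · intro j; simp
    · intro j v; simp

open Classical in
/-- The problem `HPC k`: given a hypergraph, output `1` if it has a proper `k`-coloring and `0`
otherwise. -/
noncomputable def HPC (k : ℕ) : CountableHypergraph → Set ℕ :=
  fun H => {if ∃ f : H.1.vertexSet → Fin k, IsProperColoring H.1 f then 1 else 0}

end Weihrauch

/-! Colorability of a countable hypergraph and ill-foundedness of a tree are both existence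
statements about a sequence subject to closed conditions, so each instance translates computably
into the other. `WF` answers 1 when no path exists and `HPC` answers 1 when a coloring does exist,
so the outer functional only replaces each answer `y` by `1 - y`, which needs no access to the
input.

From hypergraphs to trees (`exists_isPath_coloringTree_iff`): a path guesses a coloring and, for
each edge, two differently colored vertices of it. With these Skolem witnesses, every violation
shows up on a finite prefix.

From trees to hypergraphs (`exists_isProperColoring_treeHypergraph_iff`): "there is a path" is the
satisfiability of infinitary clauses in variables `x_σ`, namely `x_[]`, and `x_σ → ⋁ x_{σn}` over
the children `σn ∈ T`. With `K + 2` colors, `K` vertices joined to everything use up `K` colors, and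
the other two act as truth values, vertex `K` having the color "false". The edges `{x_σ, ¬x_σ}`
enforce negation. An edge made of vertex `K` and the literals of a clause is not monochromatic
exactly when some literal is true. Infinite edges are what express the infinite disjunctions. -/

namespace Weihrauch

/-! ### Digitwise decidable functionals -/

/-- A predicate on Baire space and `ℕ` is uniformly primitive recursive if it is a primitive
recursive predicate whenever the oracle is itself given primitive recursively in parameters. -/
def UniformPrimrec (P : Baire → ℕ → Prop) : Prop :=
  ∀ {α : Type} [Primcodable α] (r : α → ℕ → ℕ) (n : α → ℕ), Primrec₂ r → Primrec n →
    PrimrecPred fun a => P (r a) (n a)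

/-- `u n` bounds the part of the oracle that the truth value of `P p n` depends on. -/
def UseBound (P : Baire → ℕ → Prop) (u : ℕ → ℕ) : Prop :=
  ∀ (p q : Baire) (n : ℕ), (∀ m < u n, p m = q m) → (P p n ↔ P q n)

open Classical in
/-- The functional that writes the characteristic function of `P p`. -/
noncomputable def charFunctional (P : Baire → ℕ → Prop) (p : Baire) : Baire :=
  fun n => if P p n then 1 else 0

/-- The functional `F` applied to every member of a coded sequence. -/
def sequencewise (F : Baire → Baire) (p : Baire) : Baire :=
  fun n => F (fun m => p (Nat.pair n.unpair.1 m)) n.unpair.2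

theorem initSeg_length (p : Baire) (m : ℕ) : (initSeg p m).length = m := by
  simp [initSeg]

theorem initSeg_getD (p : Baire) {m i : ℕ} (h : i < m) : (initSeg p m).getD i 0 = p i := by
  simp [initSeg, h]

theorem initSeg_succ (p : Baire) (m : ℕ) : initSeg p (m + 1) = initSeg p m ++ [p m] := by
  simp [initSeg, List.range_succ]

/-- A prefix longer than the use bound determines the digit, so the predicate may be evaluated on
the prefix padded with zeros. The padded oracle is primitive recursive in the prefix, which is where
the uniformity of `P` enters. -/
theorem isComputable_sequencewise {P : Baire → ℕ → Prop} {u : ℕ → ℕ} (hP : UniformPrimrec P)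
    (hu : Primrec u) (hb : UseBound P u) :
    IsComputable (fun p => Part.some (sequencewise (charFunctional P) p)) := by
  classical
  -- `Nat.pair i` is strictly increasing, so a prefix of this length contains the first `u` entries
  -- of row `i`.
  let b : ℕ → ℕ := fun n => Nat.pair n.unpair.1 (u n.unpair.2)
  have hbp : Primrec b := Primrec₂.natPair.comp (Primrec.fst.comp Primrec.unpair)
    (hu.comp (Primrec.snd.comp Primrec.unpair))
  refine ⟨fun l n => if b n ≤ l.length then
    some (sequencewise (charFunctional P) (fun m => l.getD m 0) n) else none, ?_, ?_⟩
  · refine Primrec.to_comp ?_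
    refine Primrec.ite (Primrec.nat_le.comp (hbp.comp Primrec.snd)
      (Primrec.list_length.comp Primrec.fst)) (Primrec.option_some.comp ?_) (Primrec.const none)
    have hq := hP (α := List ℕ × ℕ)
      (fun a m => a.1.getD (Nat.pair a.2.unpair.1 m) 0) (fun a => a.2.unpair.2)
      ((Primrec.list_getD 0).comp (Primrec.fst.comp Primrec.fst)
        (Primrec₂.natPair.comp
          (Primrec.fst.comp (Primrec.unpair.comp (Primrec.snd.comp Primrec.fst))) Primrec.snd))
      (Primrec.snd.comp (Primrec.unpair.comp Primrec.snd))
    exact Primrec.ite hq (Primrec.const 1) (Primrec.const 0)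
  · intro p q hq n
    obtain rfl := Part.mem_some_iff.1 hq
    have key : ∀ m, b n ≤ m → sequencewise (charFunctional P) (fun i => (initSeg p m).getD i 0) n
        = sequencewise (charFunctional P) p n := by
      intro m hm
      have h := hb (fun i => (initSeg p m).getD (Nat.pair n.unpair.1 i) 0)
        (fun i => p (Nat.pair n.unpair.1 i)) n.unpair.2 fun i hi =>
          initSeg_getD p ((Nat.pair_lt_pair_right _ hi).trans_le hm)
      simp only [sequencewise, charFunctional, h]
    refine ⟨⟨b n, ?_⟩, fun m y h => ?_⟩
    · simp only [initSeg_length, le_refl, if_true, key]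
    · simp only [initSeg_length] at h
      split_ifs at h with hm
      rw [key m hm] at h
      exact (Option.some.inj h).symm

/-- The functional that negates the truth value named by each member of a coded sequence. -/
def negate (q : Baire) : Baire := fun n => 1 - q (Nat.pair n.unpair.1 0)

theorem isComputable_negate : IsComputable (fun q => Part.some (negate q)) := by
  have hi : Primrec fun n : ℕ => Nat.pair n.unpair.1 0 :=
    Primrec₂.natPair.comp (Primrec.fst.comp Primrec.unpair) (Primrec.const 0)
  refine ⟨fun l n => (l[Nat.pair n.unpair.1 0]?).map (1 - ·), ?_, ?_⟩
  · refine Primrec.to_comp ?_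
    exact Primrec.option_map
      (Primrec.list_getElem?.comp Primrec.fst (hi.comp Primrec.snd))
      (Primrec.nat_sub.comp (Primrec.const 1) Primrec.snd)
  · intro p q hq n
    obtain rfl := Part.mem_some_iff.1 hq
    refine ⟨⟨Nat.pair n.unpair.1 0 + 1, ?_⟩, fun m y h => ?_⟩
    · simp [initSeg, negate]
    · simp only [initSeg, List.getElem?_map, Option.map_map, Option.map_eq_some_iff] at h
      obtain ⟨a, ha, rfl⟩ := h
      obtain ⟨_, rfl⟩ := List.getElem?_eq_some_iff.1 ha
      simp [negate]

/-- A computable translation of instances that negates the answers gives a strong Weihrauch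
reduction between the parallelizations. -/
theorem strongReducible_parallelization {X Z : Type*} [Represented X] [Represented Z]
    {f : X → Set ℕ} {g : Z → Set ℕ} {P : Baire → ℕ → Prop} {u : ℕ → ℕ}
    (hP : UniformPrimrec P) (hu : Primrec u) (hb : UseBound P u)
    (h : ∀ p x, Represented.IsName p x → ∃ z, Represented.IsName (charFunctional P p) z ∧
      (g z).Nonempty ∧ ∀ y ∈ g z, 1 - y ∈ f x) :
    StrongReducible (parallelization f) (parallelization g) := by
  refine ⟨_, _, isComputable_negate, isComputable_sequencewise hP hu hb, ?_⟩
  intro G hG p x hp _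
  choose z hz hne hy using fun i => h _ (x i) (hp i)
  choose w hw using hne
  obtain ⟨q, hq, y, hyz, hqy⟩ := hG (sequencewise (charFunctional P) p) z
    (fun i => by simpa [sequencewise] using hz i) ⟨w, hw⟩
  refine ⟨negate q, ?_, fun i => 1 - y i, fun i => hy i _ (hyz i), fun i => ?_⟩
  · exact Part.mem_bind (Part.mem_bind (Part.mem_some _) hq) (Part.mem_some _)
  · have : q (Nat.pair i 0) = y i := hqy i
    change negate q (Nat.pair i 0) = 1 - y i
    simp [negate, this]

theorem isCharFun_iff {α : Type*} {p : Baire} {c : α → ℕ} {A : Set α} (h : IsCharFun p c A)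
    (a : α) : p (c a) = 1 ↔ a ∈ A := by
  rw [h a]
  split_ifs with ha <;> simp [ha]

theorem isCharFun_charFunctional {α : Type*} {P : Baire → ℕ → Prop} {p : Baire} {c : α → ℕ}
    {A : Set α} (h : ∀ a, P p (c a) ↔ a ∈ A) : IsCharFun (charFunctional P p) c A := by
  intro a
  by_cases ha : a ∈ A
  · simp [charFunctional, ha, (h a).2 ha]
  · simp [charFunctional, ha, (h a).not.2 ha]

theorem primrecPred_forall_lt {α : Type} [Primcodable α] {f : α → ℕ} (hf : Primrec f)
    {R : α → ℕ → Prop} (hR : PrimrecRel R) : PrimrecPred fun a => ∀ x < f a, R a x :=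
  ((PrimrecRel.forall_mem_list (R := fun (x : ℕ) (a : α) => R a x) hR.swap).comp
    (Primrec.list_range.comp hf) Primrec.id).of_eq fun a => by simp

theorem primrecPred_imp {α : Type} [Primcodable α] {P Q : α → Prop} (hP : PrimrecPred P)
    (hQ : PrimrecPred Q) : PrimrecPred fun a => P a → Q a :=
  (hP.not.or hQ).of_eq fun _ => imp_iff_not_or.symm

/-! ### Colorings of all natural numbers -/

/-- The vertices outside the edges play no role, so colorings may be taken to be total. -/
theorem exists_isProperColoring_iff (H : Hypergraph ℕ) {k : ℕ} (hk : 0 < k) :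
    (∃ f : H.vertexSet → Fin k, IsProperColoring H f) ↔
      ∃ F : ℕ → Fin k, ∀ e ∈ H.edgeSet, e.Nontrivial → ∃ u ∈ e, ∃ v ∈ e, F u ≠ F v := by
  classical
  constructor
  · rintro ⟨f, hf⟩
    refine ⟨fun v => if hv : v ∈ H.vertexSet then f ⟨v, hv⟩ else ⟨0, hk⟩, fun e he hn => ?_⟩
    obtain ⟨u, v, hu, hv, huv⟩ := hf e he hn
    exact ⟨u, hu, v, hv, by simpa using huv⟩
  · rintro ⟨F, hF⟩
    refine ⟨fun v => F v, fun e he hn => ?_⟩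
    obtain ⟨u, hu, v, hv, huv⟩ := hF e he hn
    exact ⟨⟨u, H.subset_vertexSet_of_mem_edgeSet' he hu⟩,
      ⟨v, H.subset_vertexSet_of_mem_edgeSet' he hv⟩, hu, hv, huv⟩

/-- Dependent choice: iterate a chosen one-step extension, starting from the empty sequence. -/
theorem exists_initSeg {Q : List ℕ → Prop} (h0 : Q []) (hs : ∀ σ, Q σ → ∃ n, Q (σ ++ [n])) :
    ∃ f : ℕ → ℕ, ∀ n, Q (initSeg f n) := by
  have hs' : ∀ σ, ∃ n, Q σ → Q (σ ++ [n]) := fun σ => by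
    by_cases h : Q σ
    · exact (hs σ h).imp fun n hn _ => hn
    · exact ⟨0, fun h' => absurd h' h⟩
  choose next hnext using hs'
  let seq : ℕ → List ℕ := fun n => Nat.rec [] (fun _ σ => σ ++ [next σ]) n
  have hseq : ∀ n, initSeg (fun n => next (seq n)) n = seq n := by
    intro n
    induction n with
    | zero => rfl
    | succ n ih => rw [initSeg_succ, ih]
  refine ⟨fun n => next (seq n), fun n => ?_⟩
  rw [hseq]
  induction n with
  | zero => exact h0
  | succ n ih => exact hnext _ ih

/-! ### From hypergraphs to trees -/

/-- The color that an entry of a sequence assigns to its position. -/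
def entryColor (k s : ℕ) : ℕ := s.unpair.1 % k

/-- The finite sequence `σ` is a partial `k`-coloring of the hypergraph named by `p`, together with
two differently colored vertices of each edge that is seen to be nontrivial. -/
def IsColoringAttempt (k : ℕ) (p : Baire) (σ : List ℕ) : Prop :=
  ∀ j < σ.length, ∀ a < σ.length, ∀ b < σ.length, p (Nat.pair 1 j) = 1 → a ≠ b →
    p (Nat.pair (j + 2) a) = 1 → p (Nat.pair (j + 2) b) = 1 →
    (σ.getD j 0).unpair.2.unpair.1 < σ.length → (σ.getD j 0).unpair.2.unpair.2 < σ.length →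
    p (Nat.pair (j + 2) (σ.getD j 0).unpair.2.unpair.1) = 1 ∧
    p (Nat.pair (j + 2) (σ.getD j 0).unpair.2.unpair.2) = 1 ∧
    entryColor k (σ.getD (σ.getD j 0).unpair.2.unpair.1 0) ≠
      entryColor k (σ.getD (σ.getD j 0).unpair.2.unpair.2 0)

theorem uniformPrimrec_isColoringAttempt (k : ℕ) :
    UniformPrimrec fun p n => IsColoringAttempt k p (Denumerable.ofNat (List ℕ) n) := by
  intro α _ r n hr hn
  have hσ : Primrec fun a => Denumerable.ofNat (List ℕ) (n a) := (Primrec.ofNat _).comp hn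
  have hl := Primrec.list_length.comp hσ
  refine primrecPred_forall_lt hl ?_
  refine primrecPred_forall_lt (α := α × ℕ) (hl.comp Primrec.fst) ?_
  refine primrecPred_forall_lt (α := (α × ℕ) × ℕ) (hl.comp (Primrec.fst.comp Primrec.fst)) ?_
  have ha : Primrec fun x : ((α × ℕ) × ℕ) × ℕ => x.1.1.1 :=
    Primrec.fst.comp (Primrec.fst.comp Primrec.fst)
  have hj : Primrec fun x : ((α × ℕ) × ℕ) × ℕ => x.1.1.2 :=
    Primrec.snd.comp (Primrec.fst.comp Primrec.fst)
  have hσ' := hσ.comp ha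
  have hl' := hl.comp ha
  have hget : ∀ {f : ((α × ℕ) × ℕ) × ℕ → ℕ}, Primrec f → Primrec fun x =>
      (Denumerable.ofNat (List ℕ) (n x.1.1.1)).getD (f x) 0 := fun hf =>
    (Primrec.list_getD 0).comp hσ' hf
  have hw := Primrec.unpair.comp (Primrec.snd.comp (Primrec.unpair.comp (hget hj)))
  have hedge : ∀ {f : ((α × ℕ) × ℕ) × ℕ → ℕ}, Primrec f → PrimrecPred fun x =>
      r x.1.1.1 (Nat.pair (x.1.1.2 + 2) (f x)) = 1 := fun hf =>
    Primrec.eq.comp (hr.comp ha (Primrec₂.natPair.comp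
      (Primrec.nat_add.comp hj (Primrec.const 2)) hf)) (Primrec.const 1)
  have hcol : ∀ {f : ((α × ℕ) × ℕ) × ℕ → ℕ}, Primrec f → Primrec fun x =>
      entryColor k (f x) := fun hf =>
    Primrec.nat_mod.comp (Primrec.fst.comp (Primrec.unpair.comp hf)) (Primrec.const k)
  refine primrecPred_imp (Primrec.eq.comp (hr.comp ha (Primrec₂.natPair.comp
    (Primrec.const 1) hj)) (Primrec.const 1)) ?_
  refine primrecPred_imp (Primrec.eq.comp (Primrec.snd.comp Primrec.fst) Primrec.snd).not ?_
  refine primrecPred_imp (hedge (Primrec.snd.comp Primrec.fst)) ?_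
  refine primrecPred_imp (hedge Primrec.snd) ?_
  refine primrecPred_imp (Primrec.nat_lt.comp (Primrec.fst.comp hw) hl') ?_
  refine primrecPred_imp (Primrec.nat_lt.comp (Primrec.snd.comp hw) hl') ?_
  exact (hedge (Primrec.fst.comp hw)).and ((hedge (Primrec.snd.comp hw)).and
    (Primrec.eq.comp (hcol (hget (Primrec.fst.comp hw)))
      (hcol (hget (Primrec.snd.comp hw)))).not)

theorem pair_lt_pair_of_le_of_lt {a b c d : ℕ} (h : a ≤ c) (h' : b < d) :
    Nat.pair a b < Nat.pair c d := by
  rcases h.eq_or_lt with rfl | h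
  · exact Nat.pair_lt_pair_right _ h'
  · exact (Nat.pair_lt_pair_left _ h).trans (Nat.pair_lt_pair_right _ h')

/-- Only the index row 1 and the edge rows `j + 2` with `j < σ.length` are inspected, at columns
below `σ.length`. -/
theorem IsColoringAttempt.congr {k : ℕ} {p q : Baire} {σ : List ℕ}
    (h : ∀ i ≤ σ.length + 1, ∀ a < σ.length, p (Nat.pair i a) = q (Nat.pair i a))
    (hp : IsColoringAttempt k p σ) : IsColoringAttempt k q σ := by
  intro j hj a ha b hb h1 hab hja hjb hu hv
  rw [← h _ (by omega) _ (by assumption)] at h1 hja hjb ⊢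
  rw [← h _ (by omega) _ (by assumption)]
  exact hp j hj a ha b hb h1 hab hja hjb hu hv

theorem useBound_isColoringAttempt (k : ℕ) :
    UseBound (fun p n => IsColoringAttempt k p (Denumerable.ofNat (List ℕ) n))
      fun n => Nat.pair (n + 1) n := by
  intro p q n h
  have hl : (Denumerable.ofNat (List ℕ) n).length ≤ n := by
    simpa using Encodable.length_le_encode (Denumerable.ofNat (List ℕ) n)
  have h' : ∀ i ≤ (Denumerable.ofNat (List ℕ) n).length + 1,
      ∀ a < (Denumerable.ofNat (List ℕ) n).length, p (Nat.pair i a) = q (Nat.pair i a) :=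
    fun i hi a ha => h _ (pair_lt_pair_of_le_of_lt (by omega) (by omega))
  exact ⟨IsColoringAttempt.congr h', IsColoringAttempt.congr fun i hi a ha => (h' i hi a ha).symm⟩

/-- Edges, vertices and witnesses are all tested only below the length, so lengthening a sequence
only adds conditions. A witness beyond the length counts as not yet refuted. -/
theorem IsColoringAttempt.of_append {k : ℕ} {p : Baire} {σ : List ℕ} {s : ℕ}
    (h : IsColoringAttempt k p (σ ++ [s])) : IsColoringAttempt k p σ := by
  intro j hj a ha b hb h1 hab hja hjb hu hv
  have hl : (σ ++ [s]).length = σ.length + 1 := by simp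
  have hg : ∀ i < σ.length, (σ ++ [s]).getD i 0 = σ.getD i 0 := fun i hi =>
    List.getD_append _ _ _ _ hi
  have := h j (by omega) a (by omega) b (by omega) h1 hab hja hjb
  rw [hg j hj, hl] at this
  have := this (by omega) (by omega)
  rwa [hg _ hu, hg _ hv] at this

/-- The tree of coloring attempts for the hypergraph named by `p`. -/
def coloringTree (k : ℕ) (p : Baire) : Tree :=
  ⟨{σ | IsColoringAttempt k p σ}, fun _ _ h => IsColoringAttempt.of_append h⟩

theorem mem_coloringTree {k : ℕ} {p : Baire} {σ : List ℕ} :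
    σ ∈ coloringTree k p ↔ IsColoringAttempt k p σ := Iff.rfl

/-- Entry `j` of a path codes both the color of vertex `j` and a pair of witnesses for edge `j`. -/
theorem exists_isPath_coloringTree_iff {k : ℕ} (hk : 0 < k) {p : Baire} {H : CountableHypergraph}
    (hp : Represented.IsName p H) :
    (∃ g, IsPath (coloringTree k p) g) ↔
      ∃ f : H.1.vertexSet → Fin k, IsProperColoring H.1 f := by
  classical
  obtain ⟨J, e, -, hJ, he, hE⟩ := hp
  have hJ' := fun j => isCharFun_iff hJ j
  have he' := fun j a => isCharFun_iff (he j) a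
  rw [exists_isProperColoring_iff _ hk, hE]
  constructor
  · rintro ⟨g, hg⟩
    refine ⟨fun v => ⟨entryColor k (g v), Nat.mod_lt _ hk⟩, ?_⟩
    rintro _ ⟨j, hj, rfl⟩ ⟨a, ha, b, hb, hab⟩
    set u := (g j).unpair.2.unpair.1 with hu
    set v := (g j).unpair.2.unpair.2 with hv
    -- This prefix is long enough to see the edge, two of its vertices and both witnesses, so every
    -- guard is met.
    have h := mem_coloringTree.1 (hg (j + a + b + u + v + 1)) j
    simp only [initSeg_length] at h
    have := h (by omega) a (by omega) b (by omega) ((hJ' j).2 hj) hab ((he' j a).2 ha)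
      ((he' j b).2 hb)
    rw [initSeg_getD g (by omega : j < _), ← hu, ← hv] at this
    obtain ⟨h1, h2, h3⟩ := this (by omega) (by omega)
    rw [initSeg_getD g (by omega), initSeg_getD g (by omega)] at h3
    exact ⟨u, (he' j u).1 h1, v, (he' j v).1 h2, fun h => h3 (Fin.mk.inj h)⟩
  · rintro ⟨F, hF⟩
    -- Indices without a nontrivial edge get the dummy witnesses `0, 0`, which are never tested.
    have hw : ∀ j, ∃ u v, j ∈ J → (e j).Nontrivial → u ∈ e j ∧ v ∈ e j ∧ F u ≠ F v := by
      intro j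
      by_cases h : j ∈ J ∧ (e j).Nontrivial
      · obtain ⟨u, hu, v, hv, huv⟩ := hF _ ⟨j, h.1, rfl⟩ h.2
        exact ⟨u, v, fun _ _ => ⟨hu, hv, huv⟩⟩
      · exact ⟨0, 0, fun h1 h2 => absurd ⟨h1, h2⟩ h⟩
    choose u v huv using hw
    refine ⟨fun j => Nat.pair (F j) (Nat.pair (u j) (v j)), fun m => ?_⟩
    intro j hj a ha b hb h1 hab hja hjb hul hvl
    rw [initSeg_length] at hj
    rw [initSeg_getD _ hj] at hul hvl ⊢
    rw [initSeg_length] at hul hvl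
    rw [initSeg_getD _ hul, initSeg_getD _ hvl]
    obtain ⟨h2, h3, h4⟩ := huv j ((hJ' j).1 h1) ⟨a, (he' j a).1 hja, b, (he' j b).1 hjb, hab⟩
    simp only [Nat.unpair_pair, he', entryColor, Nat.mod_eq_of_lt (F _).2]
    exact ⟨h2, h3, fun h => h4 (Fin.ext h)⟩

theorem isName_coloringTree (k : ℕ) (p : Baire) :
    Represented.IsName (charFunctional
      (fun p n => IsColoringAttempt k p (Denumerable.ofNat (List ℕ) n)) p) (coloringTree k p) :=
  isCharFun_charFunctional fun σ => by
    simp only [Denumerable.ofNat_encode]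
    rfl

theorem strongReducible_HPC_WF {k : ℕ} (hk : 0 < k) :
    StrongReducible (parallelization (HPC k)) (parallelization WF) := by
  refine strongReducible_parallelization (uniformPrimrec_isColoringAttempt k)
    (Primrec₂.natPair.comp Primrec.succ Primrec.id) (useBound_isColoringAttempt k)
    fun p H hp => ⟨coloringTree k p, isName_coloringTree k p, Set.singleton_nonempty _, ?_⟩
  intro y hy
  have h := exists_isPath_coloringTree_iff hk hp
  simp only [WF, HPC, NoInfinitePath, h, Set.mem_singleton_iff] at hy ⊢
  subst hy
  split_ifs <;> simp_all

/-! ### From trees to hypergraphs -/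

/-- The edges of the hypergraph that a tree is translated to, for `K + 2` colors. The vertices below
`K` are joined to all others, `K` stands for the truth value "false", and `K + 1 + 2 * t` and
`K + 2 + 2 * t` stand for "the node coded by `t` is on the path" and its negation. -/
def edgeMem (K : ℕ) (p : Baire) (s t v : ℕ) : Prop :=
  (s < K ∧ (v = s ∨ v = t)) ∨
  (s = K ∧ (v = K + 1 + 2 * t ∨ v = K + 2 + 2 * t)) ∨
  (s = K + 1 ∧ (v = K ∨ v = K + 1)) ∨
  (s = K + 2 ∧ (v = K ∨ v = K + 2 + 2 * t ∨
    (v = K + 1 + 2 * ((v - (K + 1)) / 2) ∧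
      Denumerable.ofNat (List ℕ) ((v - (K + 1)) / 2) ≠ [] ∧
      (Denumerable.ofNat (List ℕ) ((v - (K + 1)) / 2)).take
        ((Denumerable.ofNat (List ℕ) ((v - (K + 1)) / 2)).length - 1) =
          Denumerable.ofNat (List ℕ) t ∧
      p ((v - (K + 1)) / 2) = 1)))

/-- The digits of the name of the hypergraph that the tree named by `p` is translated to. -/
def hypergraphDigit (K : ℕ) (p : Baire) (n : ℕ) : Prop :=
  n.unpair.1 < 2 ∨
    edgeMem K p (n.unpair.1 - 2).unpair.1 (n.unpair.1 - 2).unpair.2 n.unpair.2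

theorem uniformPrimrec_hypergraphDigit (K : ℕ) : UniformPrimrec (hypergraphDigit K) := by
  intro α _ r n hr hn
  have h1 : Primrec fun a => (n a).unpair.1 := Primrec.fst.comp (Primrec.unpair.comp hn)
  have hv : Primrec fun a => (n a).unpair.2 := Primrec.snd.comp (Primrec.unpair.comp hn)
  have hst := Primrec.unpair.comp (Primrec.nat_sub.comp h1 (Primrec.const 2))
  have hs := Primrec.fst.comp hst
  have ht := Primrec.snd.comp hst
  have hx : ∀ (c : ℕ) {f : α → ℕ}, Primrec f → Primrec fun a => c + 2 * f a := fun c _ hf =>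
    Primrec.nat_add.comp (Primrec.const c) (Primrec.nat_mul.comp (Primrec.const 2) hf)
  have hw := Primrec.nat_div.comp (Primrec.nat_sub.comp hv (Primrec.const (K + 1)))
    (Primrec.const 2)
  have hτ := (Primrec.ofNat (List ℕ)).comp hw
  have heq : ∀ (c : ℕ) {f : α → ℕ}, Primrec f → PrimrecPred fun a => f a = c := fun c _ hf =>
    Primrec.eq.comp hf (Primrec.const c)
  refine (Primrec.nat_lt.comp h1 (Primrec.const 2)).or ?_
  refine PrimrecPred.or ?_ (PrimrecPred.or ?_ (PrimrecPred.or ?_ ?_))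
  · exact (Primrec.nat_lt.comp hs (Primrec.const K)).and
      ((Primrec.eq.comp hv hs).or (Primrec.eq.comp hv ht))
  · exact (heq K hs).and
      ((Primrec.eq.comp hv (hx _ ht)).or (Primrec.eq.comp hv (hx _ ht)))
  · exact (heq _ hs).and ((heq _ hv).or (heq _ hv))
  · refine (heq _ hs).and ((heq _ hv).or ((Primrec.eq.comp hv (hx _ ht)).or ?_))
    refine (Primrec.eq.comp hv (hx _ hw)).and
      ((Primrec.eq.comp hτ (Primrec.const [])).not.and (PrimrecPred.and ?_ ?_))
    · exact Primrec.eq.comp (Primrec.list_take.comp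
        (Primrec.nat_sub.comp (Primrec.list_length.comp hτ) (Primrec.const 1)) hτ)
        ((Primrec.ofNat (List ℕ)).comp ht)
    · exact heq 1 (hr.comp Primrec.id hw)

/-- The only oracle query is at the node coded by the vertex, and that code is at most `n`. -/
theorem useBound_hypergraphDigit (K : ℕ) : UseBound (hypergraphDigit K) Nat.succ := by
  intro p q n h
  have hn : n.unpair.2 ≤ n := Nat.unpair_right_le n
  have := h ((n.unpair.2 - (K + 1)) / 2) (by omega)
  simp only [hypergraphDigit, edgeMem, this]

/-- The hypergraph that the tree named by `p` is translated to. -/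
def treeHypergraph (K : ℕ) (p : Baire) : CountableHypergraph :=
  ⟨{ vertexSet := Set.univ
     edgeSet := Set.range fun j : ℕ => {v | edgeMem K p j.unpair.1 j.unpair.2 v}
     subset_vertexSet_of_mem_edgeSet' := fun _ _ => Set.subset_univ _ },
    Set.countable_range _⟩

theorem isName_treeHypergraph (K : ℕ) (p : Baire) :
    Represented.IsName (charFunctional (hypergraphDigit K) p) (treeHypergraph K p) := by
  refine ⟨Set.univ, fun j => {v | edgeMem K p j.unpair.1 j.unpair.2 v}, ?_, ?_, fun j => ?_, ?_⟩
  · exact isCharFun_charFunctional fun v => by simp [hypergraphDigit, treeHypergraph]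
  · exact isCharFun_charFunctional fun v => by simp [hypergraphDigit]
  · exact isCharFun_charFunctional fun v => by simp [hypergraphDigit]
  · simp [treeHypergraph]

/-- Decoding `v` to a node and comparing its parent with `σ` replaces the search for `n` by a
primitive recursive test. -/
theorem edgeMem_clause {K : ℕ} {p : Baire} {T : Tree} (hp : Represented.IsName p T)
    (σ : List ℕ) (v : ℕ) :
    edgeMem K p (K + 2) (Encodable.encode σ) v ↔ v = K ∨ v = K + 2 + 2 * Encodable.encode σ ∨
      ∃ n, σ ++ [n] ∈ T ∧ v = K + 1 + 2 * Encodable.encode (σ ++ [n]) := by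
  have hT : ∀ τ, p (Encodable.encode τ) = 1 ↔ τ ∈ T := fun τ => isCharFun_iff hp τ
  have h1 : ∀ w, K + 1 + 2 * w - (K + 1) = 2 * w := by omega
  simp only [edgeMem, Denumerable.ofNat_encode]
  constructor
  · rintro (h | h | h | ⟨-, h | h | ⟨h2, h3, h4, h5⟩⟩)
    · omega
    · omega
    · omega
    · exact Or.inl h
    · exact Or.inr (Or.inl h)
    · right; right
      generalize (v - (K + 1)) / 2 = w at h2 h3 h4 h5
      obtain ⟨τ, rfl⟩ : ∃ τ : List ℕ, Encodable.encode τ = w :=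
        ⟨Denumerable.ofNat _ w, Denumerable.encode_ofNat w⟩
      rw [Denumerable.ofNat_encode] at h3 h4
      rw [hT] at h5
      rw [← List.dropLast_eq_take] at h4
      have : σ ++ [τ.getLast h3] = τ := by rw [← h4, List.dropLast_append_getLast]
      exact ⟨τ.getLast h3, by rwa [this], by rwa [this]⟩
  · rintro (h | h | ⟨n, hn, rfl⟩)
    · exact Or.inr (Or.inr (Or.inr ⟨trivial, Or.inl h⟩))
    · exact Or.inr (Or.inr (Or.inr ⟨trivial, Or.inr (Or.inl h)⟩))
    · refine Or.inr (Or.inr (Or.inr ⟨trivial, Or.inr (Or.inr ?_)⟩))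
      simp only [h1, Nat.mul_div_cancel_left _ (Nat.zero_lt_two), Denumerable.ofNat_encode, hT]
      simpa using hn

/-- If the colors of `0, …, K - 1` are distinct and not used elsewhere, only one color different
from that of `K` is left for the other vertices. -/
theorem color_eq_of_ne {K : ℕ} {F : ℕ → Fin (K + 2)} (hF : ∀ s < K, ∀ t, t ≠ s → F s ≠ F t)
    {a b : ℕ} (ha : K ≤ a) (hb : K ≤ b) (haK : F a ≠ F K) (hbK : F b ≠ F K) : F a = F b := by
  -- `G` lists the colors of `0, …, K` and, at the last index, of `a`. Being injective it exhausts
  -- all colors, and `F b` can only be the last one listed.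
  let G : Fin (K + 2) → Fin (K + 2) := fun i => if (i : ℕ) ≤ K then F i else F a
  have hG : Function.Injective G := by
    intro i j hij
    by_contra hne
    have hne' : (i : ℕ) ≠ j := fun h => hne (Fin.ext h)
    have hi2 := i.2
    have hj2 := j.2
    simp only [G] at hij
    split_ifs at hij with hi hj hj
    · rcases Nat.lt_or_ge i K with h | h
      · exact hF i h j hne'.symm hij
      · exact hF j (by omega) i hne' hij.symm
    · rcases hi.lt_or_eq with h | h
      · exact hF i h a (by omega) hij
      · exact haK (by rw [← hij, h])
    · rcases hj.lt_or_eq with h | h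
      · exact hF j h a (by omega) hij.symm
      · exact haK (by rw [hij, h])
    · omega
  obtain ⟨i, hi⟩ := Finite.surjective_of_injective hG (F b)
  simp only [G] at hi
  split_ifs at hi with h
  · rcases h.lt_or_eq with h | h
    · exact absurd hi (hF i h b (by omega))
    · exact absurd (by rw [← hi, h]) hbK
  · exact hi

/-- Call a node true if its positive vertex differs in color from `K`. The root is true, and the
clause edge of a true node yields a true child in `T`: that edge contains `K`, and the negated
literal has the color of `K`. -/
theorem exists_isPath_of_coloring {K : ℕ} {p : Baire} {T : Tree} (hp : Represented.IsName p T)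
    {F : ℕ → Fin (K + 2)} (hF : ∀ s t, {v | edgeMem K p s t v}.Nontrivial →
      ∃ u, edgeMem K p s t u ∧ ∃ v, edgeMem K p s t v ∧ F u ≠ F v) :
    ∃ f, IsPath T f := by
  have huniv : ∀ s < K, ∀ t, t ≠ s → F s ≠ F t := by
    intro s hs t hts
    have hm : ∀ v, edgeMem K p s t v ↔ v = s ∨ v = t := fun v => by
      simp only [edgeMem]; omega
    obtain ⟨u, hu, v, hv, huv⟩ := hF s t ⟨s, (hm s).2 (.inl rfl), t, (hm t).2 (.inr rfl), hts.symm⟩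
    rcases (hm u).1 hu with rfl | rfl <;> rcases (hm v).1 hv with rfl | rfl
    exacts [absurd rfl huv, huv, huv.symm, absurd rfl huv]
  have hlit : ∀ t, F (K + 1 + 2 * t) ≠ F (K + 2 + 2 * t) := by
    intro t
    have hm : ∀ v, edgeMem K p K t v ↔ v = K + 1 + 2 * t ∨ v = K + 2 + 2 * t := fun v => by
      simp [edgeMem]
    obtain ⟨u, hu, v, hv, huv⟩ := hF K t ⟨_, (hm _).2 (.inl rfl), _, (hm _).2 (.inr rfl), by omega⟩
    rcases (hm u).1 hu with rfl | rfl <;> rcases (hm v).1 hv with rfl | rfl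
    exacts [absurd rfl huv, huv, huv.symm, absurd rfl huv]
  have hroot : F (K + 1) ≠ F K := by
    have hm : ∀ v, edgeMem K p (K + 1) 0 v ↔ v = K ∨ v = K + 1 := fun v => by
      simp [edgeMem]
    obtain ⟨u, hu, v, hv, huv⟩ :=
      hF (K + 1) 0 ⟨_, (hm _).2 (.inl rfl), _, (hm _).2 (.inr rfl), by omega⟩
    rcases (hm u).1 hu with rfl | rfl <;> rcases (hm v).1 hv with rfl | rfl
    exacts [absurd rfl huv, huv.symm, huv, absurd rfl huv]
  have hstep : ∀ σ : List ℕ, F (K + 1 + 2 * Encodable.encode σ) ≠ F K →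
      ∃ n, F (K + 1 + 2 * Encodable.encode (σ ++ [n])) ≠ F K ∧ σ ++ [n] ∈ T := by
    intro σ hσ
    have hm := edgeMem_clause (K := K) hp σ
    have hneg : F (K + 2 + 2 * Encodable.encode σ) = F K := by
      by_contra h
      exact hlit _ (color_eq_of_ne huniv (by omega) (by omega) hσ h)
    obtain ⟨u, hu, v, hv, huv⟩ := hF (K + 2) (Encodable.encode σ)
      ⟨_, (hm _).2 (.inl rfl), _, (hm _).2 (.inr (.inl rfl)), by omega⟩
    have hgood : ∀ u, edgeMem K p (K + 2) (Encodable.encode σ) u → F u ≠ F K →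
        ∃ n, F (K + 1 + 2 * Encodable.encode (σ ++ [n])) ≠ F K ∧ σ ++ [n] ∈ T := by
      intro u hu huK
      rcases (hm u).1 hu with rfl | rfl | ⟨n, hn, rfl⟩
      · exact absurd rfl huK
      · exact absurd hneg huK
      · exact ⟨n, huK, hn⟩
    by_cases h : F u = F K
    · exact hgood v hv fun h' => huv (h.trans h'.symm)
    · exact hgood u hu h
  -- The empty sequence has code 0, so vertex `K + 1` is the root literal.
  have h0 : F (K + 1 + 2 * Encodable.encode ([] : List ℕ)) ≠ F K := by simpa using hroot
  -- The root edge does not test membership in `T`; it follows from that of a child.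
  have hnil : [] ∈ T := by
    obtain ⟨n, -, hn⟩ := hstep [] h0
    exact Descriptive.Tree.mem_of_append hn
  obtain ⟨f, hf⟩ := exists_initSeg
    (Q := fun σ => F (K + 1 + 2 * Encodable.encode σ) ≠ F K ∧ σ ∈ T) ⟨h0, hnil⟩
    fun σ h => hstep σ h.1
  exact ⟨f, fun n => (hf n).2⟩

theorem exists_coloring_of_isPath {K : ℕ} {p : Baire} {T : Tree} (hp : Represented.IsName p T)
    {f : ℕ → ℕ} (hf : IsPath T f) :
    ∃ F : ℕ → Fin (K + 2), ∀ s t, {v | edgeMem K p s t v}.Nontrivial →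
      ∃ u, edgeMem K p s t u ∧ ∃ v, edgeMem K p s t v ∧ F u ≠ F v := by
  classical
  let on : ℕ → Prop := fun t => ∃ n, Encodable.encode (initSeg f n) = t
  -- Vertices up to `K` keep their own number as color. Among literals, even offset from `K + 1`
  -- means positive, and a literal gets the "true" color `K + 1` exactly when its sign agrees with
  -- its node being on the path.
  let c : ℕ → ℕ := fun v => if v ≤ K then v else
    if ((v - (K + 1)) % 2 = 0 ↔ on ((v - (K + 1)) / 2)) then K + 1 else K
  have hc : ∀ v, c v < K + 2 := by
    intro v
    simp only [c]
    split_ifs <;> omega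
  have hpos : ∀ t, c (K + 1 + 2 * t) = if on t then K + 1 else K := by
    intro t
    have h1 : ¬ K + 1 + 2 * t ≤ K := by omega
    simp [c, h1]
  have hneg : ∀ t, c (K + 2 + 2 * t) = if on t then K else K + 1 := by
    intro t
    have h1 : ¬ K + 2 + 2 * t ≤ K := by omega
    have h2 : ¬ (K + 2 + 2 * t - (K + 1)) % 2 = 0 := by omega
    have h3 : (K + 2 + 2 * t - (K + 1)) / 2 = t := by omega
    by_cases h : on t <;> simp only [c, h1, h2, h3, h, if_true, if_false, iff_true]
  have hsmall : ∀ v ≤ K, c v = v := fun v hv => if_pos hv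
  suffices h : ∀ s t, {v | edgeMem K p s t v}.Nontrivial →
      ∃ u, edgeMem K p s t u ∧ ∃ v, edgeMem K p s t v ∧ c u ≠ c v by
    refine ⟨fun v => ⟨c v, hc v⟩, fun s t hst => ?_⟩
    obtain ⟨u, hu, v, hv, huv⟩ := h s t hst
    exact ⟨u, hu, v, hv, fun h => huv (Fin.mk.inj h)⟩
  intro s t hst
  rcases lt_or_ge s K with hs | hs
  · have hm : ∀ v, edgeMem K p s t v ↔ v = s ∨ v = t := fun v => by
      simp only [edgeMem]; omega
    have hts : t ≠ s := by
      rintro rfl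
      obtain ⟨a, ha, b, hb, hab⟩ := hst
      have := (hm a).1 ha
      have := (hm b).1 hb
      omega
    refine ⟨s, (hm s).2 (.inl rfl), t, (hm t).2 (.inr rfl), ?_⟩
    rw [hsmall s hs.le]
    simp only [c]
    split_ifs <;> omega
  by_cases hs0 : s = K
  · subst hs0
    refine ⟨s + 1 + 2 * t, ?_, s + 2 + 2 * t, ?_, ?_⟩
    · simp [edgeMem]
    · simp [edgeMem]
    · rw [hpos, hneg]
      split_ifs <;> omega
  by_cases hs1 : s = K + 1
  · subst hs1
    refine ⟨K, by simp [edgeMem], K + 1, by simp [edgeMem], ?_⟩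
    have := hpos 0
    rw [if_pos ⟨0, by simp [initSeg]⟩] at this
    rw [hsmall K le_rfl]
    simp only [Nat.mul_zero, Nat.add_zero] at this
    omega
  by_cases hs2 : s = K + 2
  · subst hs2
    obtain ⟨σ, rfl⟩ : ∃ σ : List ℕ, Encodable.encode σ = t :=
      ⟨Denumerable.ofNat _ t, Denumerable.encode_ofNat t⟩
    have hm := edgeMem_clause (K := K) hp σ
    refine ⟨K, (hm K).2 (.inl rfl), ?_⟩
    rw [hsmall K le_rfl]
    -- For a node on the path, the next node of the path is the true literal of the clause;
    -- otherwise the negated literal is.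
    by_cases hon : on (Encodable.encode σ)
    · obtain ⟨n, hn⟩ := hon
      obtain rfl := Encodable.encode_injective hn
      refine ⟨_, (hm _).2 (.inr (.inr ⟨f n, ?_, rfl⟩)), ?_⟩
      · rw [← initSeg_succ]
        exact hf _
      · rw [← initSeg_succ, hpos, if_pos ⟨n + 1, rfl⟩]
        omega
    · refine ⟨_, (hm _).2 (.inr (.inl rfl)), ?_⟩
      rw [hneg, if_neg hon]
      omega
  -- For `s > K + 2` the edge is empty.
  · obtain ⟨a, ha, -⟩ := hst
    change edgeMem K p s t a at ha
    simp only [edgeMem] at ha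
    omega

theorem exists_isProperColoring_treeHypergraph_iff {K : ℕ} {p : Baire} {T : Tree}
    (hp : Represented.IsName p T) :
    (∃ f : (treeHypergraph K p).1.vertexSet → Fin (K + 2),
      IsProperColoring (treeHypergraph K p).1 f) ↔ ∃ f, IsPath T f := by
  rw [exists_isProperColoring_iff _ (Nat.succ_pos _)]
  constructor
  · rintro ⟨F, hF⟩
    exact exists_isPath_of_coloring hp (F := F) fun s t h =>
      hF {v | edgeMem K p s t v} ⟨Nat.pair s t, by simp⟩ h
  · rintro ⟨f, hf⟩
    obtain ⟨F, hF⟩ := exists_coloring_of_isPath (K := K) hp hf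
    refine ⟨F, ?_⟩
    rintro _ ⟨j, rfl⟩ h
    exact hF _ _ h

theorem strongReducible_WF_HPC (K : ℕ) :
    StrongReducible (parallelization WF) (parallelization (HPC (K + 2))) := by
  refine strongReducible_parallelization (uniformPrimrec_hypergraphDigit K) Primrec.succ
    (useBound_hypergraphDigit K)
    fun p T hp => ⟨treeHypergraph K p, isName_treeHypergraph K p, Set.singleton_nonempty _, ?_⟩
  intro y hy
  have h := exists_isProperColoring_treeHypergraph_iff (K := K) hp
  simp only [WF, HPC, NoInfinitePath, h, Set.mem_singleton_iff] at hy ⊢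
  subst hy
  split_ifs <;> simp_all

end Weihrauch

theorem corollary9 (k : ℕ) (hk : 2 ≤ k) :
    Weihrauch.StrongEquiv (Weihrauch.parallelization Weihrauch.WF)
      (Weihrauch.parallelization (Weihrauch.HPC k)) := by
  obtain ⟨K, rfl⟩ := Nat.exists_eq_add_of_le' hk
  exact ⟨Weihrauch.strongReducible_WF_HPC K, Weihrauch.strongReducible_HPC_WF (Nat.succ_pos _)⟩
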